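/- **Theorem 1.2.** Let $M=\mathbb H^3/\Gamma$ be an almost Fuchsian $3$-manifold: $\Gamma$ is a finitely generated, torsion-free, discrete group of orientation-preserving isometries of $\mathbb H^3$ without parabolic elements, whose limit set is a Jordan curve and which leaves each component of its region of discontinuity invariant, and $M$ contains a closed embedded minimal surface $S$ that represents the fundamental group of $M$ and has all principal curvatures in $(-1,1)$. Let $\nu$ be a unit normal field on $S$, and for $r\in\mathbb R$ let $S(r)=\{\exp_p(r\nu):p\in S\}$ be the parallel surface at signed distance $r$, with the conformal structure of its induced metric, identified with $S$ along the normal geodesics $p\mapsto \exp_p(r\nu)$. Let $d_T$ be the Teichmüller distance $\tfrac12\log\inf_f K[f]$, where $f$ ranges over the quasiconformal maps homotopic to the identity and $K[f]$ is the maximal dilatation, and let $\lambda_0$ be the maximal principal curvature of $S$. Then for all $r,r_1,r_2\in\mathbb R$: 1. $\displaystyle d_T(S,S(r))\le \frac12\left|\log\frac{1+\lambda_0\tanh r}{1-\lambda_0\tanh r}\right|$; 2. $\displaystyle d_T(S(r_1),S(r_2))\le \frac12\left|\log\frac{1+\lambda_0\tanh r_2}{1-\lambda_0\tanh r_2}-\log\frac{1+\lambda_0\tanh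 r_1}{1-\lambda_0\tanh r_1}\right|$; 3. the normal flow map $S(r_1)\to S(r_2)$, $\exp_p(r_1\nu)\mapsto\exp_p(r_2\nu)$, has at every point a Beltrami coefficient of modulus at most $\displaystyle \frac{\lambda_0|\tanh r_2-\tanh r_1|}{1-\lambda_0^2\tanh r_1\tanh r_2}$. -/

import Mathlib

open Set Filter Topology MeasureTheory
open scoped Manifold ContDiff

noncomputable section

namespace AlmostFuchsian

/-! ### Hyperbolic 3-space as the hyperboloid in Minkowski space -/

/-- The ambient vector space `ℝ^{1,3}`; coordinate `0` is the time coordinate. -/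
abbrev Mink : Type := Fin 4 → ℝ

/-- The Minkowski form of signature `(-,+,+,+)`. -/
def mink (x y : Mink) : ℝ := -(x 0 * y 0) + x 1 * y 1 + x 2 * y 2 + x 3 * y 3

/-- Hyperbolic space `ℍ³`: the upper sheet of the hyperboloid `⟨x,x⟩ = -1`. Its Riemannian metric
is the restriction of the Minkowski form to the tangent spaces `T_x ℍ³ = {v | ⟨x,v⟩ = 0}`. -/
def H3 : Type := {x : Mink // mink x x = -1 ∧ 0 < x 0}

instance : TopologicalSpace H3 := instTopologicalSpaceSubtype

/-- The unit tangent bundle `T¹ℍ³`: pairs `(x, v)` with `x ∈ ℍ³` and `v` a unit tangent vector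
at `x`. -/
structure T1H3 where
  pos : Mink
  vec : Mink
  pos_form : mink pos pos = -1
  pos_time : 0 < pos 0
  orth : mink pos vec = 0
  unit : mink vec vec = 1

/-- The foot point of a unit tangent vector. -/
def T1H3.base (u : T1H3) : H3 := ⟨u.pos, u.pos_form, u.pos_time⟩

/-- `(1,0,0,0)` with the tangent vector `(0,1,0,0)`. -/
instance : Nonempty T1H3 :=
  ⟨{ pos := ![1, 0, 0, 0], vec := ![0, 1, 0, 0]
     pos_form := by simp [mink], pos_time := by simp, orth := by simp [mink]
     unit := by simp [mink] }⟩

lemma T1H3.time_pos_flow (u : T1H3) (r : ℝ) :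
    0 < Real.cosh r * u.pos 0 + Real.sinh r * u.vec 0 := by
  have h1 := u.pos_form
  have h2 := u.pos_time
  have h3 := u.orth
  have h4 := u.unit
  simp only [mink] at h1 h3 h4
  set a := u.pos 0
  set b := u.vec 0
  have key : (a * b) ^ 2 ≤ (a ^ 2 - 1) * (b ^ 2 + 1) := by
    have e1 : a * b = u.pos 1 * u.vec 1 + u.pos 2 * u.vec 2 + u.pos 3 * u.vec 3 := by linarith
    have e2 : a ^ 2 - 1 = u.pos 1 ^ 2 + u.pos 2 ^ 2 + u.pos 3 ^ 2 := by linarith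
    have e3 : b ^ 2 + 1 = u.vec 1 ^ 2 + u.vec 2 ^ 2 + u.vec 3 ^ 2 := by linarith
    rw [e1, e2, e3]
    nlinarith [sq_nonneg (u.pos 1 * u.vec 2 - u.pos 2 * u.vec 1),
      sq_nonneg (u.pos 1 * u.vec 3 - u.pos 3 * u.vec 1),
      sq_nonneg (u.pos 2 * u.vec 3 - u.pos 3 * u.vec 2)]
  have hb : |b| < a := abs_lt_of_sq_lt_sq (by nlinarith) h2.le
  have hs : |Real.sinh r| < Real.cosh r :=
    abs_lt_of_sq_lt_sq (by nlinarith [Real.cosh_sq r]) (Real.cosh_pos r).le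
  have h5 : |Real.sinh r * b| ≤ Real.cosh r * |b| := by
    rw [abs_mul]; exact mul_le_mul_of_nonneg_right hs.le (abs_nonneg _)
  have h6 : Real.cosh r * |b| < Real.cosh r * a := mul_lt_mul_of_pos_left hb (Real.cosh_pos r)
  have h7 := neg_abs_le (Real.sinh r * b)
  linarith

/-- The geodesic flow on `T¹ℍ³`: the unit tangent vector at time `r` of the unit speed geodesic
`r ↦ exp_x (r v) = cosh r • x + sinh r • v` with initial data `(x, v)`. -/
def T1H3.flow (r : ℝ) (u : T1H3) : T1H3 where
  pos := Real.cosh r • u.pos + Real.sinh r • u.vec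
  vec := Real.sinh r • u.pos + Real.cosh r • u.vec
  pos_form := by
    have h1 := u.pos_form
    have h3 := u.orth
    have h4 := u.unit
    simp only [mink, Pi.add_apply, Pi.smul_apply, smul_eq_mul] at *
    linear_combination (Real.cosh r) ^ 2 * h1 + 2 * Real.cosh r * Real.sinh r * h3
      + (Real.sinh r) ^ 2 * h4 - Real.cosh_sq r
  pos_time := by simpa using u.time_pos_flow r
  orth := by
    have h1 := u.pos_form
    have h3 := u.orth
    have h4 := u.unit
    simp only [mink, Pi.add_apply, Pi.smul_apply, smul_eq_mul] at *
    linear_combination Real.cosh r * Real.sinh r * h1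
      + ((Real.cosh r) ^ 2 + (Real.sinh r) ^ 2) * h3 + Real.sinh r * Real.cosh r * h4
  unit := by
    have h1 := u.pos_form
    have h3 := u.orth
    have h4 := u.unit
    simp only [mink, Pi.add_apply, Pi.smul_apply, smul_eq_mul] at *
    linear_combination (Real.sinh r) ^ 2 * h1 + 2 * Real.cosh r * Real.sinh r * h3
      + (Real.cosh r) ^ 2 * h4 + Real.cosh_sq r

/-! ### Quasi-Fuchsian groups -/

/-- The group containing all the isometry groups considered here. -/
abbrev SL4 : Type := Matrix.SpecialLinearGroup (Fin 4) ℝ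

/-- `A ∈ SO⁺(1,3)`, i.e. the linear map `A` of determinant one restricts to an orientation
preserving isometry of `ℍ³`. All such isometries arise in this way, from a unique `A`. -/
def IsHypIsometry (A : SL4) : Prop :=
  (∀ x y : Mink, mink (A.1.mulVec x) (A.1.mulVec y) = mink x y) ∧
    ∀ x : H3, 0 < A.1.mulVec x.1 0

/-- The sphere at infinity `∂ℍ³`: the rays of the future light cone, each represented by its point
of time coordinate `1`. -/
def sphereInfty : Set Mink := {ξ | mink ξ ξ = 0 ∧ ξ 0 = 1}

/-- Radial projection to the affine hyperplane `x₀ = 1`. It embeds `ℍ³` as the open unit ball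
(Klein model) bounded by `sphereInfty`. -/
def klein (x : Mink) : Mink := (x 0)⁻¹ • x

/-- The action of an isometry on the sphere at infinity. -/
def bdryAct (A : SL4) (ξ : Mink) : Mink := klein (A.1.mulVec ξ)

/-- The limit set: the accumulation points of orbits `Γ(p)`, `p ∈ ℍ³`, on the sphere at infinity. -/
def limitSet (Γ : Subgroup SL4) : Set Mink :=
  {ξ | ξ ∈ sphereInfty ∧
    ∃ p : H3, AccPt ξ (𝓟 {y : Mink | ∃ A ∈ Γ, y = klein (A.1.mulVec p.1)})}

/-- The region of discontinuity. -/
def discontinuitySet (Γ : Subgroup SL4) : Set Mink := sphereInfty \ limitSet Γ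

/-- A parabolic isometry: no fixed point in `ℍ³` and exactly one on the sphere at infinity. -/
def IsParabolic (A : SL4) : Prop :=
  (∀ x : H3, A.1.mulVec x.1 ≠ x.1) ∧ ∃! ξ : Mink, ξ ∈ sphereInfty ∧ bdryAct A ξ = ξ

/-- Quasi-Fuchsian groups without parabolics: finitely generated, torsion free Kleinian groups
whose limit set is a closed Jordan curve and which leave each component of the region of
discontinuity invariant. -/
structure IsQuasiFuchsian (Γ : Subgroup SL4) : Prop where
  isometry : ∀ A ∈ Γ, IsHypIsometry A
  properlyDiscontinuous : ∀ K : Set H3, IsCompact K →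
    {A : SL4 | A ∈ Γ ∧ ∃ x ∈ K, ∃ y ∈ K, A.1.mulVec x.1 = y.1}.Finite
  torsionFree : ∀ A ∈ Γ, ∀ n : ℕ, 0 < n → A ^ n = 1 → A = 1
  fg : Γ.FG
  noParabolics : ∀ A ∈ Γ, ¬ IsParabolic A
  jordanCurve : ∃ c : Circle → Mink, Continuous c ∧ Function.Injective c ∧ range c = limitSet Γ
  componentsInvariant : ∀ A ∈ Γ, ∀ ξ ∈ discontinuitySet Γ,
    bdryAct A ξ ∈ connectedComponentIn (discontinuitySet Γ) ξ

/-! ### The hyperbolic manifold `M = ℍ³/Γ` -/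

/-- Equivalence of points of `ℍ³` under `Γ`. -/
def pointSetoid (Γ : Subgroup SL4) : Setoid H3 where
  r x y := ∃ A ∈ Γ, A.1.mulVec x.1 = y.1
  iseqv :=
    { refl := fun _ => ⟨1, Γ.one_mem, by simp⟩
      symm := by
        rintro x y ⟨A, hA, h⟩
        refine ⟨A⁻¹, Γ.inv_mem hA, ?_⟩
        rw [← h, Matrix.mulVec_mulVec, ← Matrix.SpecialLinearGroup.coe_mul]; simp
      trans := by
        rintro x y z ⟨A, hA, h⟩ ⟨B, hB, h'⟩
        refine ⟨B * A, Γ.mul_mem hB hA, ?_⟩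
        rw [← h', ← h, Matrix.mulVec_mulVec, ← Matrix.SpecialLinearGroup.coe_mul] }

/-- Equivalence of unit tangent vectors of `ℍ³` under `Γ` (acting by its differential). -/
def tangentSetoid (Γ : Subgroup SL4) : Setoid T1H3 where
  r u w := ∃ A ∈ Γ, A.1.mulVec u.pos = w.pos ∧ A.1.mulVec u.vec = w.vec
  iseqv :=
    { refl := fun _ => ⟨1, Γ.one_mem, by simp⟩
      symm := by
        rintro x y ⟨A, hA, h, k⟩
        refine ⟨A⁻¹, Γ.inv_mem hA, ?_, ?_⟩
        · rw [← h, Matrix.mulVec_mulVec, ← Matrix.SpecialLinearGroup.coe_mul]; simp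
        · rw [← k, Matrix.mulVec_mulVec, ← Matrix.SpecialLinearGroup.coe_mul]; simp
      trans := by
        rintro x y z ⟨A, hA, h, k⟩ ⟨B, hB, h', k'⟩
        refine ⟨B * A, Γ.mul_mem hB hA, ?_, ?_⟩
        · rw [← h', ← h, Matrix.mulVec_mulVec, ← Matrix.SpecialLinearGroup.coe_mul]
        · rw [← k', ← k, Matrix.mulVec_mulVec, ← Matrix.SpecialLinearGroup.coe_mul] }

/-- The quotient `M = ℍ³/Γ`, with the quotient topology. -/
def Quot3 (Γ : Subgroup SL4) : Type := Quotient (pointSetoid Γ)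

instance (Γ : Subgroup SL4) : TopologicalSpace (Quot3 Γ) :=
  inferInstanceAs (TopologicalSpace (Quotient (pointSetoid Γ)))

/-- The unit tangent bundle `T¹M = T¹ℍ³/Γ`. -/
def T1M (Γ : Subgroup SL4) : Type := Quotient (tangentSetoid Γ)

/-- The projection `T¹ℍ³ → T¹M`. -/
def T1M.mk (Γ : Subgroup SL4) (u : T1H3) : T1M Γ := Quotient.mk (tangentSetoid Γ) u

/-- The foot point map `T¹M → M`. -/
def T1M.base {Γ : Subgroup SL4} : T1M Γ → Quot3 Γ :=
  Quotient.map T1H3.base fun _ _ ⟨A, hA, h, _⟩ => ⟨A, hA, h⟩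

/-- The geodesic flow on `T¹M`. -/
def T1M.flow {Γ : Subgroup SL4} (r : ℝ) : T1M Γ → T1M Γ :=
  Quotient.map (T1H3.flow r) (by
    rintro u w ⟨A, hA, h, k⟩
    refine ⟨A, hA, ?_, ?_⟩ <;>
      simp only [T1H3.flow, Matrix.mulVec_add, Matrix.mulVec_smul, h, k])

/-! ### Surfaces in `M` -/

section Surfaces

/-- Smooth surfaces are modelled on the Euclidean plane. -/
abbrev E2 : Type := EuclideanSpace ℝ (Fin 2)

variable {S : Type*} [TopologicalSpace S] [ChartedSpace E2 S] {Γ : Subgroup SL4}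

/-- A field of bilinear forms on the tangent planes of a surface. -/
abbrev FormField (S : Type*) [TopologicalSpace S] [ChartedSpace E2 S] : Type _ :=
  ∀ p : S, TangentSpace (𝓡 2) p → TangentSpace (𝓡 2) p → ℝ

/-- The differential of a Minkowski space valued map. -/
def diffl (F : S → Mink) (p : S) (v : TangentSpace (𝓡 2) p) : Mink :=
  mfderiv (𝓡 2) 𝓘(ℝ, Mink) F p v

/-- A two-sided surface in `M` is given by `N : S → T¹M`: the foot point of `N p` is the position
of `p` in `M`, and `N p` is the unit normal there. A local lift of `N` at `p` is a map
`L = (F, ν)` to `T¹ℍ³`, smooth at `p`, that projects to `N` near `p`. -/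
def IsLocalLift (N : S → T1M Γ) (p : S) (L : S → T1H3) : Prop :=
  (∀ᶠ q in 𝓝 p, T1M.mk Γ (L q) = N q) ∧
  ContMDiffAt (𝓡 2) 𝓘(ℝ, Mink) ∞ (fun q => (L q).pos) p ∧
  ContMDiffAt (𝓡 2) 𝓘(ℝ, Mink) ∞ (fun q => (L q).vec) p

/-- `N` is a smooth immersion of `S` in `M` together with a smooth unit normal field: `N` has local
lifts `(F, ν)` at every point, `dF` is injective, and `ν` is normal to the image of `dF`. -/
def IsImmersedSurface (N : S → T1M Γ) : Prop :=
  ∀ p, ∃ L, IsLocalLift N p L ∧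
    (∀ v, diffl (fun q => (L q).pos) p v = 0 → v = 0) ∧
    ∀ᶠ q in 𝓝 p, ∀ v, mink (diffl (fun q => (L q).pos) q v) (L q).vec = 0

/-- A local lift at `p` (for an immersed surface; it is unique up to an element of `Γ`). -/
def localLift (N : S → T1M Γ) (p : S) : S → T1H3 := Classical.epsilon (IsLocalLift N p)

/-- The first fundamental form (induced metric) `⟨dF v, dF w⟩`. -/
def firstForm (N : S → T1M Γ) : FormField S := fun p v w =>
  mink (diffl (fun q => (localLift N p q).pos) p v) (diffl (fun q => (localLift N p q).pos) p w)

/-- The second fundamental form `⟨dF v, dν w⟩`. The component of `dν w` tangent to `ℍ³` is the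
covariant derivative of `ν`. -/
def secondForm (N : S → T1M Γ) : FormField S := fun p v w =>
  mink (diffl (fun q => (localLift N p q).pos) p v) (diffl (fun q => (localLift N p q).vec) p w)

/-- `(v, w)` is an orthonormal frame at `p` for the metric `g`. -/
def IsOrthoFrame (g : FormField S) (p : S) (v w : TangentSpace (𝓡 2) p) : Prop :=
  g p v v = 1 ∧ g p w w = 1 ∧ g p v w = 0

/-- The mean curvature (trace of the second fundamental form) vanishes. -/
def IsMinimal (N : S → T1M Γ) : Prop :=
  ∀ p v w, IsOrthoFrame (firstForm N) p v w → secondForm N p v v + secondForm N p w w = 0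

/-- `κ` is a principal curvature at `p`: an eigenvalue of the second fundamental form with respect
to the first. -/
def IsPrincipalCurvature (N : S → T1M Γ) (p : S) (κ : ℝ) : Prop :=
  ∃ v, v ≠ 0 ∧ ∀ w, secondForm N p v w = κ * firstForm N p v w

/-- `λ₀`: the maximal principal curvature. -/
def maxPrincipalCurvature (N : S → T1M Γ) : ℝ := sSup {κ | ∃ p, IsPrincipalCurvature N p κ}

/-- `S`, placed in `M = ℍ³/Γ` by `N`, is an embedded minimal surface that represents the fundamental
group of `M` and has principal curvatures in `(-1,1)`. (`M` is almost Fuchsian when it is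
quasi-Fuchsian and contains such a closed surface.) -/
structure IsAlmostFuchsianSurface (N : S → T1M Γ) : Prop where
  immersed : IsImmersedSurface N
  continuous : Continuous fun p => (N p).base
  embedded : Function.Injective fun p => (N p).base
  fundamentalGroup : ∀ p : S, Function.Bijective
    (FundamentalGroup.map (⟨fun p => (N p).base, continuous⟩ : C(S, Quot3 Γ)) p)
  minimal : IsMinimal N
  curvature : ∀ p κ, IsPrincipalCurvature N p κ → -1 < κ ∧ κ < 1

/-- The parallel surface `S(r)`: the points `exp_p (r ν)` with their unit normals. It is
parametrized by `S` along the normal geodesics, so in terms of these parametrizations the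
normal flow map `S(r₁) → S(r₂)` is the identity map of `S`. -/
def parallelSurface (N : S → T1M Γ) (r : ℝ) : S → T1M Γ := fun p => (N p).flow r

/-! ### Quasiconformal maps and the Teichmüller distance -/

/-- The Beltrami coefficient `(E - G + 2iF) / (E + G + 2√(EG - F²))` of the quadratic form with
`E = b v v`, `F = b v w`, `G = b w w`. If `(v, w)` is an orthonormal frame at `p` for a metric `g`
and `b` the pullback by `f` of a metric, it is the Beltrami coefficient of `f` at `p` with
respect to a `g`-conformal coordinate `z = x + i y` such that `v = ∂/∂x`, `w = ∂/∂y` at `p` up to a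
positive factor. Its modulus does not depend on the orthonormal frame. -/
def beltrami {V : Type*} (b : V → V → ℝ) (v w : V) : ℂ :=
  (((b v v - b w w : ℝ) : ℂ) + 2 * Complex.I * ((b v w : ℝ) : ℂ)) /
    ((b v v + b w w + 2 * √(b v v * b w w - b v w ^ 2) : ℝ) : ℂ)

/-- The pullback of the metric `g` by the differential of `f` at `p`. -/
def pullback (g : FormField S) (f : S → S) (p : S) (v w : TangentSpace (𝓡 2) p) : ℝ :=
  g (f p) (mfderiv (𝓡 2) (𝓡 2) f p v) (mfderiv (𝓡 2) (𝓡 2) f p w)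

/-- A subset of `S` of measure zero (in every chart). -/
def IsNullSet (A : Set S) : Prop :=
  ∀ p : S, volume (chartAt E2 p '' (A ∩ (chartAt E2 p).source)) = 0

/-- Absolute continuity on lines in a subset `U` of the plane: on every closed rectangle in
`U`, `h` is absolutely continuous on almost every horizontal and almost every vertical segment. -/
def IsACL (U : Set E2) (h : E2 → E2) : Prop :=
  ∀ a b c d : ℝ, a ≤ b → c ≤ d → (∀ x ∈ Icc a b, ∀ y ∈ Icc c d, !₂[x, y] ∈ U) →
    (∀ᵐ y : ℝ, y ∈ Icc c d → AbsolutelyContinuousOnInterval (fun x => h !₂[x, y]) a b) ∧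
    (∀ᵐ x : ℝ, x ∈ Icc a b → AbsolutelyContinuousOnInterval (fun y => h !₂[x, y]) c d)

/-- The homeomorphism `f : (S, g₁) → (S, g₂)` is `K`-quasiconformal (`K ≥ 1`), by the analytic
definition: it is ACL in charts, and almost everywhere it is differentiable with Beltrami
coefficient of modulus at most `(K - 1) / (K + 1)`. (Below `f` is homotopic to the identity, so
that it preserves the orientation.) -/
def IsQuasiconformalWith (g₁ g₂ : FormField S) (f : S ≃ₜ S) (K : ℝ) : Prop :=
  1 ≤ K ∧
  (∀ p : S, IsACL
    (chartAt E2 p '' ((chartAt E2 p).source ∩ f ⁻¹' (chartAt E2 (f p)).source))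
    (chartAt E2 (f p) ∘ f ∘ (chartAt E2 p).symm)) ∧
  IsNullSet {p : S | ¬ (MDifferentiableAt (𝓡 2) (𝓡 2) f p ∧
    ∀ v w, IsOrthoFrame g₁ p v w → ‖beltrami (pullback g₂ f p) v w‖ ≤ (K - 1) / (K + 1))}

/-- The maximal dilatation `K[f]` of a quasiconformal map. -/
def maxDilatation (g₁ g₂ : FormField S) (f : S ≃ₜ S) : ℝ :=
  sInf {K | IsQuasiconformalWith g₁ g₂ f K}

/-- The Teichmüller distance of the conformal structures on `S` given by two Riemannian metrics:
`½ log inf K[f]` over all quasiconformal maps `f : (S, g₁) → (S, g₂)` homotopic to the identity. -/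
def teichDist (g₁ g₂ : FormField S) : ℝ :=
  1 / 2 * Real.log (sInf {k | ∃ f : S ≃ₜ S,
    ContinuousMap.Homotopic (f : C(S, S)) (ContinuousMap.id S) ∧
    (∃ K, IsQuasiconformalWith g₁ g₂ f K) ∧ k = maxDilatation g₁ g₂ f})

end Surfaces

end AlmostFuchsian

end

open AlmostFuchsian

namespace AlmostFuchsian

/-! ### The Minkowski form -/

/-! In the hyperboloid model the normal flow is linear: if `(F, ν)` lifts the surface, then `cosh r
• F + sinh r • ν` lifts `S(r)`. Minimality makes the shape operator trace free, so a frame of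
principal directions has `dν e₁ = l dF e₁` and `dν e₂ = -l dF e₂`. In this one frame the metrics of
all parallel surfaces are diagonal at once, with entries `(cosh r ± l sinh r)²`
(`exists_frame_parallelSurface`); `|l| < 1` keeps `cosh r ± l sinh r` positive for every `r`.

The Beltrami modulus of the identity between two such metrics is then explicit (`norm_beltrami_eq`),
namely `|l| |t₂ - t₁| / (1 - l² t₁ t₂)` with `tᵢ = tanh rᵢ`. It increases with `|l| ≤ λ₀`, which
gives the pointwise bound. The bound at `λ₀` equals `(K - 1)/(K + 1)` for `log K` the claimed
difference of logarithms, and the identity competes in the infimum defining the Teichmüller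
distance.

Two preliminaries support this. The fundamental forms are defined by a chosen local lift and must
not depend on it (`IsLocalLift.forms_eq`), which follows from the free, properly discontinuous
action of `Γ`. The second fundamental form must be symmetric (`IsLocalLift.mink_diffl_symm`), which
follows from the symmetry of second derivatives. -/

lemma mink_comm (x y : Mink) : mink x y = mink y x := by
  simp only [mink]; ring

lemma mink_add_left (x y z : Mink) : mink (x + y) z = mink x z + mink y z := by
  simp only [mink, Pi.add_apply]; ring

lemma mink_smul_left (a : ℝ) (x y : Mink) : mink (a • x) y = a * mink x y := by
  simp only [mink, Pi.smul_apply, smul_eq_mul]; ring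

lemma mink_add_right (x y z : Mink) : mink x (y + z) = mink x y + mink x z := by
  simp only [mink, Pi.add_apply]; ring

lemma mink_smul_right (a : ℝ) (x y : Mink) : mink x (a • y) = a * mink x y := by
  simp only [mink, Pi.smul_apply, smul_eq_mul]; ring

/-- The Minkowski form as a continuous bilinear map. -/
noncomputable def minkCLM : Mink →L[ℝ] Mink →L[ℝ] ℝ :=
  (LinearMap.mk₂ ℝ mink mink_add_left mink_smul_left mink_add_right
    mink_smul_right).toContinuousBilinearMap

lemma minkCLM_apply (x y : Mink) : minkCLM x y = mink x y := rfl

lemma hasFDerivAt_mink {E : Type*} [NormedAddCommGroup E] [NormedSpace ℝ E] {f g : E → Mink}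
    {f' g' : E →L[ℝ] Mink} {x : E} (hf : HasFDerivAt f f' x) (hg : HasFDerivAt g g' x) :
    HasFDerivAt (fun y => mink (f y) (g y))
      ((minkCLM.precompR E (f x)) g' + (minkCLM.precompL E f') (g x)) x :=
  minkCLM.hasFDerivAt_of_bilinear hf hg

/-- If `⟨f, g⟩` is locally constant then `⟨f, dg⟩ + ⟨df, g⟩ = 0`. -/
lemma mink_fderiv_of_eventually_const {E : Type*} [NormedAddCommGroup E] [NormedSpace ℝ E]
    {f g : E → Mink} {x : E} {c : ℝ} (hf : DifferentiableAt ℝ f x) (hg : DifferentiableAt ℝ g x)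
    (h : ∀ᶠ y in 𝓝 x, mink (f y) (g y) = c) (v : E) :
    mink (f x) (fderiv ℝ g x v) + mink (fderiv ℝ f x v) (g x) = 0 := by
  have h1 := hasFDerivAt_mink hf.hasFDerivAt hg.hasFDerivAt
  have h2 : HasFDerivAt (fun y => mink (f y) (g y)) (0 : E →L[ℝ] ℝ) x :=
    (hasFDerivAt_const c x).congr_of_eventuallyEq h
  simpa [minkCLM_apply] using congrArg (fun T : E →L[ℝ] ℝ => T v) (h1.unique h2)

/-- A vector orthogonal to a Minkowski-orthonormal basis vanishes. -/
lemma eq_zero_of_orthogonal_frame {a b c d x : Mink} (haa : mink a a = -1) (hbb : mink b b = 1)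
    (hcc : mink c c = 1) (hdd : mink d d = 1) (hab : mink a b = 0) (hac : mink a c = 0)
    (had : mink a d = 0) (hbc : mink b c = 0) (hbd : mink b d = 0) (hcd : mink c d = 0)
    (ha : mink a x = 0) (hb : mink b x = 0) (hc : mink c x = 0) (hd : mink d x = 0) : x = 0 := by
  let M : Matrix (Fin 4) (Fin 4) ℝ := Matrix.of ![a, b, c, d]
  let J : Matrix (Fin 4) (Fin 4) ℝ := Matrix.diagonal ![-1, 1, 1, 1]
  have hMJ : ∀ y : Mink, (M * J).mulVec y = ![mink a y, mink b y, mink c y, mink d y] := by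
    intro y
    ext i
    fin_cases i <;>
      simp [M, J, Matrix.mulVec, dotProduct, Fin.sum_univ_four, mink, Matrix.mul_diagonal]
  -- Orthonormality says that the Gram matrix of the frame is `J`; as `det J ≠ 0`, the matrix `M *
  -- J` of pairings with the frame is invertible.
  have hMM : M * J * M.transpose = J := by
    ext i j
    have := congrFun (hMJ (M j)) i
    rw [Matrix.mul_apply]
    simp only [Matrix.mulVec, dotProduct] at this
    simp only [Matrix.transpose_apply]
    rw [this]
    have e1 := mink_comm b a
    have e2 := mink_comm c a
    have e3 := mink_comm c b
    have e4 := mink_comm d a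
    have e5 := mink_comm d b
    have e6 := mink_comm d c
    have m0 : M 0 = a := rfl
    have m1 : M 1 = b := rfl
    have m2 : M 2 = c := rfl
    have m3 : M 3 = d := rfl
    clear_value M
    fin_cases i <;> fin_cases j <;> simp [J, *]
  have hdet : IsUnit (M * J).det := by
    rw [isUnit_iff_ne_zero]
    intro h0
    have h1 := congrArg Matrix.det hMM
    rw [Matrix.det_mul, h0] at h1
    simp [J, Matrix.det_diagonal, Fin.prod_univ_four] at h1
  have hinj := Matrix.mulVec_injective_of_isUnit ((Matrix.isUnit_iff_isUnit_det _).2 hdet)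
  apply hinj
  rw [hMJ, ha, hb, hc, hd]
  ext i
  fin_cases i <;> simp

/-- Vectors orthogonal to a timelike vector are spacelike. -/
lemma mink_self_pos {x v : Mink} (hx : mink x x = -1) (hv : mink x v = 0) (h : v ≠ 0) :
    0 < mink v v := by
  by_contra! hle
  simp only [mink] at hx hv hle
  -- Cauchy–Schwarz for the spatial parts. With `hle` it bounds `x₀²|v'|²` by `(x₀² - 1)|v'|²`,
  -- where `v'` is the spatial part of `v`, so `v' = 0`.
  have hxv : (x 0 * v 0) ^ 2 ≤ (x 0 ^ 2 - 1) * (v 1 ^ 2 + v 2 ^ 2 + v 3 ^ 2) := by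
    have e1 : x 0 * v 0 = x 1 * v 1 + x 2 * v 2 + x 3 * v 3 := by linarith
    have e2 : x 0 ^ 2 - 1 = x 1 ^ 2 + x 2 ^ 2 + x 3 ^ 2 := by linarith
    rw [e1, e2]
    nlinarith [sq_nonneg (x 1 * v 2 - x 2 * v 1), sq_nonneg (x 1 * v 3 - x 3 * v 1),
      sq_nonneg (x 2 * v 3 - x 3 * v 2)]
  have hs : v 1 ^ 2 + v 2 ^ 2 + v 3 ^ 2 ≤ 0 := by
    have : x 0 ^ 2 * (v 1 ^ 2 + v 2 ^ 2 + v 3 ^ 2) ≤ x 0 ^ 2 * v 0 ^ 2 :=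
      mul_le_mul_of_nonneg_left (by linarith) (sq_nonneg _)
    linarith
  have h1 : v 1 = 0 := by nlinarith [sq_nonneg (v 1), sq_nonneg (v 2), sq_nonneg (v 3)]
  have h2 : v 2 = 0 := by nlinarith [sq_nonneg (v 1), sq_nonneg (v 2), sq_nonneg (v 3)]
  have h3 : v 3 = 0 := by nlinarith [sq_nonneg (v 1), sq_nonneg (v 2), sq_nonneg (v 3)]
  have h0 : v 0 = 0 := by
    have hx0 : 1 ≤ x 0 ^ 2 := by nlinarith [sq_nonneg (x 1), sq_nonneg (x 2), sq_nonneg (x 3)]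
    have hxv0 : x 0 * v 0 = 0 := by rw [h1, h2, h3] at hv; linarith
    rcases mul_eq_zero.1 hxv0 with h | h
    · rw [h] at hx0; norm_num at hx0
    · exact h
  exact h (by ext i; fin_cases i <;> assumption)

/-! ### Uniqueness of local lifts -/

/-- The squared length of the spatial part is `x₀² - 1`, so a height bound bounds every coordinate.
These sets are the compacta to which proper discontinuity is applied. -/
lemma isCompact_H3_le (R : ℝ) : IsCompact {x : H3 | x.1 0 ≤ R} := by
  have key : IsCompact (X := {x : Mink // mink x x = -1 ∧ 0 < x 0}) {x | x.1 0 ≤ R} := by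
    rw [Subtype.isCompact_iff]
    have hc : Continuous fun x : Mink => mink x x := by unfold mink; fun_prop
    -- The open condition `0 < x₀` may be relaxed to a closed one because `x₀ = 0` is impossible on
    -- the hyperboloid.
    have heq : (Subtype.val '' {x : {x : Mink // mink x x = -1 ∧ 0 < x 0} | x.1 0 ≤ R}) =
        {x : Mink | mink x x = -1} ∩ ({x | 0 ≤ x 0} ∩ {x | x 0 ≤ R}) := by
      ext x
      constructor
      · rintro ⟨y, hy, rfl⟩
        exact ⟨y.2.1, y.2.2.le, hy⟩
      · rintro ⟨h1, h2, h3⟩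
        refine ⟨⟨x, h1, lt_of_le_of_ne h2 fun h => ?_⟩, h3, rfl⟩
        simp only [mem_ofPred_eq, mink, ← h] at h1
        nlinarith [sq_nonneg (x 1), sq_nonneg (x 2), sq_nonneg (x 3)]
    rw [heq]
    refine (isCompact_Icc (a := fun _ : Fin 4 => -|R|) (b := fun _ => |R|)).of_isClosed_subset ?_ ?_
    · exact (isClosed_eq hc continuous_const).inter
        ((isClosed_le continuous_const (continuous_apply 0)).inter
          (isClosed_le (continuous_apply 0) continuous_const))
    · rintro x ⟨h1, h2, h3⟩
      simp only [mem_ofPred_eq, mink] at h1 h2 h3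
      have hR : |R| = R := abs_of_nonneg (h2.trans h3)
      have hi : ∀ i, |x i| ≤ |R| := by
        intro i
        apply abs_le_of_sq_le_sq' _ (abs_nonneg _) |> abs_le.2
        rw [hR]
        have : x 0 ^ 2 ≤ R ^ 2 := by gcongr
        fin_cases i <;> simp only [Fin.zero_eta, Fin.mk_one, Fin.reduceFinMk] <;>
          nlinarith [sq_nonneg (x 1), sq_nonneg (x 2), sq_nonneg (x 3)]
      exact ⟨fun i => (abs_le.1 (hi i)).1, fun i => (abs_le.1 (hi i)).2⟩
  exact key

/-- A torsion free Kleinian group acts freely on `ℍ³`. -/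
lemma IsQuasiFuchsian.eq_one_of_fixed {Γ : Subgroup SL4} (hΓ : IsQuasiFuchsian Γ) {A : SL4}
    (hA : A ∈ Γ) {x : H3} (hx : A.1.mulVec x.1 = x.1) : A = 1 := by
  -- The stabilizer of `x` is finite, but by torsion freeness it would contain infinitely many
  -- distinct powers of a nontrivial `A`.
  have hfin := hΓ.properlyDiscontinuous {x} isCompact_singleton
  have hpow : ∀ n : ℕ, (A ^ n).1.mulVec x.1 = x.1 := by
    intro n
    induction n with
    | zero => simp
    | succ n ih =>
      rw [pow_succ]
      change (((A ^ n * A : SL4)) : Matrix (Fin 4) (Fin 4) ℝ).mulVec x.1 = x.1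
      rw [Matrix.SpecialLinearGroup.coe_mul, ← Matrix.mulVec_mulVec]
      change (A ^ n).1.mulVec (A.1.mulVec x.1) = x.1
      rw [hx, ih]
  by_contra hne
  have hinj : Function.Injective fun n : ℕ => A ^ n := by
    intro m n hmn
    by_contra hmn'
    wlog hlt : m < n generalizing m n
    · exact this hmn.symm (Ne.symm hmn') (lt_of_le_of_ne (not_lt.1 hlt) (Ne.symm hmn'))
    refine hne (hΓ.torsionFree A hA (n - m) (by omega) ?_)
    simp only at hmn
    rw [← Nat.add_sub_cancel' hlt.le, pow_add] at hmn
    simpa using hmn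
  exact Set.infinite_range_of_injective hinj (hfin.subset (by
    rintro _ ⟨n, rfl⟩
    exact ⟨Γ.pow_mem hA n, x, rfl, x, rfl, hpow n⟩))

section

variable {S : Type*} [TopologicalSpace S] [ChartedSpace E2 S] {Γ : Subgroup SL4}

/-- Two local lifts differ by an element of `Γ`. -/
lemma IsLocalLift.exists_eventually_eq (hΓ : IsQuasiFuchsian Γ) {N : S → T1M Γ} {p : S}
    {L L' : S → T1H3} (hL : IsLocalLift N p L) (hL' : IsLocalLift N p L') :
    ∃ A ∈ Γ, ∀ᶠ q in 𝓝 p,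
      A.1.mulVec (L q).pos = (L' q).pos ∧ A.1.mulVec (L q).vec = (L' q).vec := by
  have hc := hL.2.1.continuousAt
  have hc' := hL'.2.1.continuousAt
  have hmk : ∀ᶠ q in 𝓝 p, ∃ A ∈ Γ,
      A.1.mulVec (L q).pos = (L' q).pos ∧ A.1.mulVec (L q).vec = (L' q).vec := by
    filter_upwards [hL.1, hL'.1] with q h1 h2
    exact Quotient.exact (h1.trans h2.symm)
  -- Near `p` both lifts stay below height `R`, so only finitely many elements of `Γ` can relate
  -- them there.
  set R := max ((L p).pos 0) ((L' p).pos 0) + 1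
  have hR : (L p).pos 0 < R := lt_of_le_of_lt (le_max_left _ _) (lt_add_one _)
  have hR' : (L' p).pos 0 < R := lt_of_le_of_lt (le_max_right _ _) (lt_add_one _)
  have hfin := hΓ.properlyDiscontinuous _ (isCompact_H3_le R)
  have hlt : ∀ᶠ q in 𝓝 p, (L q).pos 0 < R :=
    ((continuous_apply 0).continuousAt.comp hc).eventually_lt_const hR
  have hlt' : ∀ᶠ q in 𝓝 p, (L' q).pos 0 < R :=
    ((continuous_apply 0).continuousAt.comp hc').eventually_lt_const hR'
  obtain ⟨A, hA, hAp, -⟩ := hmk.self_of_nhds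
  have huniq : ∀ B ∈ Γ, B.1.mulVec (L p).pos = (L' p).pos → B = A := by
    intro B hB hBp
    have h1 : (A⁻¹ * B).1.mulVec (L p).base.1 = (L p).base.1 := by
      change (((A⁻¹ * B : SL4)) : Matrix (Fin 4) (Fin 4) ℝ).mulVec (L p).pos = (L p).pos
      rw [Matrix.SpecialLinearGroup.coe_mul, ← Matrix.mulVec_mulVec]
      change (A⁻¹).1.mulVec (B.1.mulVec (L p).pos) = (L p).pos
      rw [hBp, ← hAp, Matrix.mulVec_mulVec, ← Matrix.SpecialLinearGroup.coe_mul]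
      simp
    have := hΓ.eq_one_of_fixed (Γ.mul_mem (Γ.inv_mem hA) hB) h1
    exact (inv_mul_eq_one.1 this).symm
  -- By freeness only `A` relates the lifts at `p`; each of the finitely many others fails at `p`,
  -- hence near `p` by continuity.
  have hne : ∀ᶠ q in 𝓝 p, ∀ B ∈ {B : SL4 | B ∈ Γ ∧ ∃ x ∈ {x : H3 | x.1 0 ≤ R},
      ∃ y ∈ {x : H3 | x.1 0 ≤ R}, B.1.mulVec x.1 = y.1},
      B.1.mulVec (L q).pos = (L' q).pos → B = A := by
    rw [hfin.eventually_all]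
    intro B hB
    by_cases hBp : B.1.mulVec (L p).pos = (L' p).pos
    · exact Eventually.of_forall fun _ _ => huniq B hB.1 hBp
    · have hcB : ContinuousAt (fun q => B.1.mulVec (L q).pos) p :=
        (B.1.mulVecLin.continuous_of_finiteDimensional.continuousAt).comp hc
      filter_upwards [hcB.ne_iff_eventually_ne hc' |>.1 hBp] with q hq h
      exact absurd h hq
  refine ⟨A, hA, ?_⟩
  filter_upwards [hmk, hlt, hlt', hne] with q ⟨B, hB, h1, h2⟩ h3 h4 h5
  obtain rfl := h5 B ⟨hB, (L q).base, h3.le, (L' q).base, h4.le, h1⟩ h1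
  exact ⟨h1, h2⟩

lemma diffl_mulVec {F G : S → Mink} {p : S} {A : Matrix (Fin 4) (Fin 4) ℝ}
    (hF : MDifferentiableAt (𝓡 2) 𝓘(ℝ, Mink) F p) (h : ∀ᶠ q in 𝓝 p, A.mulVec (F q) = G q)
    (v : TangentSpace (𝓡 2) p) : diffl G p v = A.mulVec (diffl F p v) := by
  have h1 : G =ᶠ[𝓝 p] (A.mulVecLin.toContinuousLinearMap ∘ F) := by
    filter_upwards [h] with q hq using hq.symm
  unfold diffl
  rw [h1.mfderiv_eq, mfderiv_comp p
    A.mulVecLin.toContinuousLinearMap.differentiableAt.mdifferentiableAt hF,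
    ContinuousLinearMap.mfderiv_eq]
  rfl

lemma IsLocalLift.mdiff_pos {N : S → T1M Γ} {p : S} {L : S → T1H3} (hL : IsLocalLift N p L) :
    MDifferentiableAt (𝓡 2) 𝓘(ℝ, Mink) (fun q => (L q).pos) p :=
  hL.2.1.mdifferentiableAt (by simp)

lemma IsLocalLift.mdiff_vec {N : S → T1M Γ} {p : S} {L : S → T1H3} (hL : IsLocalLift N p L) :
    MDifferentiableAt (𝓡 2) 𝓘(ℝ, Mink) (fun q => (L q).vec) p :=
  hL.2.2.mdifferentiableAt (by simp)

/-- The fundamental forms can be computed from any local lift. -/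
lemma IsLocalLift.forms_eq (hΓ : IsQuasiFuchsian Γ) {N : S → T1M Γ} {p : S} {L : S → T1H3}
    (hL : IsLocalLift N p L) (v w : TangentSpace (𝓡 2) p) :
    firstForm N p v w = mink (diffl (fun q => (L q).pos) p v) (diffl (fun q => (L q).pos) p w) ∧
    secondForm N p v w =
      mink (diffl (fun q => (L q).pos) p v) (diffl (fun q => (L q).vec) p w) := by
  -- The chosen lift is a genuine one because some lift exists; it differs from `L` by an isometry,
  -- which cancels in the Minkowski products.
  have hL' : IsLocalLift N p (localLift N p) := Classical.epsilon_spec (p := IsLocalLift N p) ⟨L, hL⟩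
  obtain ⟨A, hA, h⟩ := hL.exists_eventually_eq hΓ hL'
  have hpos := diffl_mulVec hL.mdiff_pos (h.mono fun _ h => h.1)
  have hvec := diffl_mulVec hL.mdiff_vec (h.mono fun _ h => h.2)
  have hi := (hΓ.isometry A hA).1
  unfold firstForm secondForm
  rw [hpos, hpos, hvec, hi, hi]
  exact ⟨rfl, rfl⟩

/-- Flowing a local lift gives a local lift of the parallel surface. -/
lemma IsLocalLift.flow {N : S → T1M Γ} {p : S} {L : S → T1H3} (hL : IsLocalLift N p L) (r : ℝ) :
    IsLocalLift (parallelSurface N r) p (fun q => (L q).flow r) := by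
  have hs : ∀ (c : ℝ) {f : S → Mink}, ContMDiffAt (𝓡 2) 𝓘(ℝ, Mink) ∞ f p →
      ContMDiffAt (𝓡 2) 𝓘(ℝ, Mink) ∞ (fun q => c • f q) p := fun c _ hf =>
    (contDiff_const_smul c).contMDiff.contMDiffAt.comp p hf
  refine ⟨?_, ?_, ?_⟩
  · filter_upwards [hL.1] with q hq
    change T1M.flow r (T1M.mk Γ (L q)) = T1M.flow r (N q)
    rw [hq]
  · exact (hs _ hL.2.1).add (hs _ hL.2.2)
  · exact (hs _ hL.2.1).add (hs _ hL.2.2)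

lemma IsLocalLift.diffl_flow_pos {N : S → T1M Γ} {p : S} {L : S → T1H3} (hL : IsLocalLift N p L)
    (r : ℝ) (v : TangentSpace (𝓡 2) p) :
    diffl (fun q => ((L q).flow r).pos) p v =
      Real.cosh r • diffl (fun q => (L q).pos) p v +
        Real.sinh r • diffl (fun q => (L q).vec) p v := by
  have h := ((hL.mdiff_pos.hasMFDerivAt.const_smul (Real.cosh r)).add
    (hL.mdiff_vec.hasMFDerivAt.const_smul (Real.sinh r))).mfderiv
  exact congrArg (fun T : E2 →L[ℝ] Mink => T v) h

end

lemma parallelSurface_zero {S : Type*} {Γ : Subgroup SL4} (N : S → T1M Γ) : parallelSurface N 0 = N := by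
  funext p
  change T1M.flow 0 (N p) = N p
  generalize N p = u
  induction u using Quotient.inductionOn with
  | h u =>
    change T1M.mk Γ (u.flow 0) = T1M.mk Γ u
    congr 1
    cases u
    simp [T1H3.flow]

/-! ### The differential of a local lift in a chart -/

section Chart

variable {S : Type*} [TopologicalSpace S] [ChartedSpace E2 S]

/-- A map read in the preferred chart at `p`. -/
noncomputable def inChart (p : S) (F : S → Mink) : E2 → Mink := F ∘ (extChartAt (𝓡 2) p).symm

lemma contDiffAt_inChart {F : S → Mink} {p : S} {n : ℕ∞ω}
    (hF : ContMDiffAt (𝓡 2) 𝓘(ℝ, Mink) n F p) :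
    ContDiffAt ℝ n (inChart p F) (extChartAt (𝓡 2) p p) := by
  have := (contMDiffAt_iff.1 hF).2
  rw [ModelWithCorners.Boundaryless.range_eq_univ, contDiffWithinAt_univ] at this
  exact this

lemma diffl_eq_fderiv {F : S → Mink} {p : S} (hF : MDifferentiableAt (𝓡 2) 𝓘(ℝ, Mink) F p)
    (v : TangentSpace (𝓡 2) p) :
    diffl F p v = fderiv ℝ (inChart p F) (extChartAt (𝓡 2) p p) v := by
  unfold diffl
  rw [hF.mfderiv]
  simp [writtenInExtChartAt, inChart]
  rfl

lemma inChart_apply_self (F : S → Mink) (p : S) :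
    inChart p F (extChartAt (𝓡 2) p p) = F p := by
  simp [inChart]

lemma tendsto_extChartAt_symm (p : S) :
    Tendsto (extChartAt (𝓡 2) p).symm (𝓝 (extChartAt (𝓡 2) p p)) (𝓝 p) := by
  have := continuousAt_extChartAt_symm (I := 𝓡 2) p
  unfold ContinuousAt at this
  rwa [extChartAt_to_inv] at this

variable [IsManifold (𝓡 2) ∞ S]

/-- Near `p`, the differential in the chart at `p` factors through the manifold differential. -/
lemma eventually_fderiv_inChart {F : S → Mink} {p : S}
    (hF : ContMDiffAt (𝓡 2) 𝓘(ℝ, Mink) ∞ F p) :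
    ∀ᶠ x in 𝓝 (extChartAt (𝓡 2) p p), ∀ v, ∃ w,
      fderiv ℝ (inChart p F) x v = diffl F ((extChartAt (𝓡 2) p).symm x) w := by
  have : IsManifold (𝓡 2) 1 S := IsManifold.of_le (n := ∞) (by simp)
  -- Being `C^∞` at a point does not by definition spread to a neighbourhood; finite order does, and
  -- order one suffices.
  have h1 : ∀ᶠ q in 𝓝 p, ContMDiffAt (𝓡 2) 𝓘(ℝ, Mink) 1 F q :=
    (contMDiffAt_iff_contMDiffAt_nhds (by simp)).1 (hF.of_le (by simp))
  filter_upwards [(tendsto_extChartAt_symm p).eventually h1,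
    extChartAt_target_mem_nhds (I := 𝓡 2) p] with x hx hxt v
  have hs : MDifferentiableAt 𝓘(ℝ, E2) (𝓡 2) (extChartAt (𝓡 2) p).symm x := by
    have := mdifferentiableWithinAt_extChartAt_symm hxt
    rwa [ModelWithCorners.Boundaryless.range_eq_univ, mdifferentiableWithinAt_univ] at this
  have hc := mfderiv_comp x (hx.mdifferentiableAt (by simp)) hs
  rw [← mfderiv_eq_fderiv]
  exact ⟨mfderiv 𝓘(ℝ, E2) (𝓡 2) (extChartAt (𝓡 2) p).symm x v, congrArg (fun T : E2 →L[ℝ] Mink => T v) hc⟩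

end Chart

/-! ### Structure equations of a local lift -/

section Lift

variable {S : Type*} [TopologicalSpace S] [ChartedSpace E2 S] {Γ : Subgroup SL4}
  {N : S → T1M Γ} {p : S} {L : S → T1H3}

/-- Differentiate `⟨F, F⟩ = -1`, `⟨ν, ν⟩ = 1` and `⟨F, ν⟩ = 0`. Once `ν` is normal to the surface,
the third relation shows that `dν` is tangent to `ℍ³`. -/
lemma IsLocalLift.mink_diffl (hL : IsLocalLift N p L) (v : TangentSpace (𝓡 2) p) :
    mink (L p).pos (diffl (fun q => (L q).pos) p v) = 0 ∧
    mink (L p).vec (diffl (fun q => (L q).vec) p v) = 0 ∧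
    mink (L p).pos (diffl (fun q => (L q).vec) p v) +
      mink (diffl (fun q => (L q).pos) p v) (L p).vec = 0 := by
  have hF := (contDiffAt_inChart hL.2.1).differentiableAt (by simp)
  have hG := (contDiffAt_inChart hL.2.2).differentiableAt (by simp)
  rw [diffl_eq_fderiv hL.mdiff_pos, diffl_eq_fderiv hL.mdiff_vec]
  have h1 := mink_fderiv_of_eventually_const hF hF
    (Eventually.of_forall fun x => (L ((extChartAt (𝓡 2) p).symm x)).pos_form) v
  have h2 := mink_fderiv_of_eventually_const hG hG
    (Eventually.of_forall fun x => (L ((extChartAt (𝓡 2) p).symm x)).unit) v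
  have h3 := mink_fderiv_of_eventually_const hF hG
    (Eventually.of_forall fun x => (L ((extChartAt (𝓡 2) p).symm x)).orth) v
  rw [inChart_apply_self] at h1 h2
  rw [inChart_apply_self, inChart_apply_self] at h3
  refine ⟨?_, ?_, h3⟩
  · linarith [mink_comm (L p).pos (fderiv ℝ (inChart p fun q => (L q).pos) (extChartAt (𝓡 2) p p) v)]
  · linarith [mink_comm (L p).vec (fderiv ℝ (inChart p fun q => (L q).vec) (extChartAt (𝓡 2) p p) v)]

/-- The second fundamental form is symmetric. -/
lemma IsLocalLift.mink_diffl_symm [IsManifold (𝓡 2) ∞ S] (hL : IsLocalLift N p L)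
    (hn : ∀ᶠ q in 𝓝 p, ∀ v, mink (diffl (fun q => (L q).pos) q v) (L q).vec = 0)
    (v w : TangentSpace (𝓡 2) p) :
    mink (diffl (fun q => (L q).pos) p v) (diffl (fun q => (L q).vec) p w) =
      mink (diffl (fun q => (L q).pos) p w) (diffl (fun q => (L q).vec) p v) := by
  set F : E2 → Mink := inChart p fun q => (L q).pos with hFdef
  set G : E2 → Mink := inChart p fun q => (L q).vec with hGdef
  set x := extChartAt (𝓡 2) p p with hx
  have hF : ContDiffAt ℝ ∞ F x := contDiffAt_inChart hL.2.1
  have hG : DifferentiableAt ℝ G x := (contDiffAt_inChart hL.2.2).differentiableAt (by simp)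
  have h2 : (2 : ℕ∞ω) ≤ ∞ := 
    WithTop.coe_le_coe.2 (le_top : (2 : ℕ∞) ≤ ⊤)
  have hDF : DifferentiableAt ℝ (fderiv ℝ F) x :=
    (hF.fderiv_right (m := 1) h2).differentiableAt (by simp)
  have hsymm : IsSymmSndFDerivAt ℝ F x :=
    hF.isSymmSndFDerivAt (by rw [minSmoothness_of_isRCLikeNormedField]; exact h2)
  have hortho : ∀ᶠ y in 𝓝 x, ∀ u, mink (fderiv ℝ F y u) (G y) = 0 := by
    filter_upwards [eventually_fderiv_inChart hL.2.1,
      (tendsto_extChartAt_symm p).eventually hn] with y h1 h2 u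
    obtain ⟨u', hu'⟩ := h1 u
    rw [hFdef, hu']
    exact h2 u'
  -- Differentiating `⟨dF u, ν⟩ = 0` along `u'` expresses the second fundamental form as `-⟨D²F(u',
  -- u), ν⟩`, which is symmetric.
  have key : ∀ u u' : E2, mink (fderiv ℝ F x u) (fderiv ℝ G x u') +
      mink (fderiv ℝ (fderiv ℝ F) x u' u) (G x) = 0 := by
    intro u u'
    have hDu : HasFDerivAt (fun y => fderiv ℝ F y u)
        ((ContinuousLinearMap.apply ℝ Mink u).comp (fderiv ℝ (fderiv ℝ F) x)) x :=
      (ContinuousLinearMap.apply ℝ Mink u).hasFDerivAt.comp x hDF.hasFDerivAt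
    have := mink_fderiv_of_eventually_const hDu.differentiableAt hG
      (hortho.mono fun y hy => hy u) u'
    rwa [hDu.fderiv] at this
  rw [diffl_eq_fderiv hL.mdiff_pos, diffl_eq_fderiv hL.mdiff_vec, diffl_eq_fderiv hL.mdiff_pos,
    diffl_eq_fderiv hL.mdiff_vec]
  have h1 := key v w
  have h2 := key w v
  rw [hsymm.eq w v] at h1
  linarith

end Lift

/-! ### The shape operator of a minimal surface -/

/-- The trace free symmetric matrix with entries `a, b, -a` is diagonalized by a rotation. -/
lemma exists_diagonalizing_rotation (a b : ℝ) :
    ∃ c s l : ℝ, c ^ 2 + s ^ 2 = 1 ∧ a * c ^ 2 + 2 * b * c * s - a * s ^ 2 = l ∧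
      -(2 * a) * c * s + b * (c ^ 2 - s ^ 2) = 0 := by
  -- Rotating the frame by `t` turns the pair `(a, b)` through `2t`, so half the argument of `a +
  -- ib` removes the off-diagonal entry.
  set z : ℂ := ⟨a, b⟩
  set t := z.arg / 2
  have hc : ‖z‖ * Real.cos (2 * t) = a := by
    rw [mul_div_cancel₀ _ two_ne_zero]; exact Complex.norm_mul_cos_arg z
  have hs : ‖z‖ * Real.sin (2 * t) = b := by
    rw [mul_div_cancel₀ _ two_ne_zero]; exact Complex.norm_mul_sin_arg z
  refine ⟨Real.cos t, Real.sin t, _, Real.cos_sq_add_sin_sq t, rfl, ?_⟩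
  rw [← hc, ← hs, Real.cos_two_mul, Real.sin_two_mul]
  linear_combination (-2 * ‖z‖ * Real.sin t * Real.cos t) * Real.cos_sq_add_sin_sq t

/-- The eigenframe of the shape operator of a minimal surface element: `P`, `Q` are the
differentials of the position and of the unit normal. -/
lemma exists_principal_frame {x n : Mink} (hxx : mink x x = -1) (hnn : mink n n = 1)
    (hxn : mink x n = 0) (P Q : E2 →ₗ[ℝ] Mink) (hP : ∀ v, P v = 0 → v = 0)
    (hxP : ∀ v, mink x (P v) = 0) (hnP : ∀ v, mink n (P v) = 0)
    (hxQ : ∀ v, mink x (Q v) = 0) (hnQ : ∀ v, mink n (Q v) = 0)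
    (hsymm : ∀ v w, mink (P v) (Q w) = mink (P w) (Q v))
    (hmin : ∀ v w, mink (P v) (P v) = 1 → mink (P w) (P w) = 1 → mink (P v) (P w) = 0 →
      mink (P v) (Q v) + mink (P w) (Q w) = 0) :
    ∃ (e₁ e₂ : E2) (l : ℝ), mink (P e₁) (P e₁) = 1 ∧ mink (P e₂) (P e₂) = 1 ∧
      mink (P e₁) (P e₂) = 0 ∧ Q e₁ = l • P e₁ ∧ Q e₂ = (-l) • P e₂ ∧
      ∀ v, ∃ α β : ℝ, v = α • e₁ + β • e₂ := by
  have hpos : ∀ v, v ≠ 0 → 0 < mink (P v) (P v) := fun v hv =>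
    mink_self_pos hxx (hxP v) fun h => hv (hP v h)
  have hnormalize : ∀ v, v ≠ 0 → ∃ c : ℝ, mink (P (c • v)) (P (c • v)) = 1 := by
    intro v hv
    have h := hpos v hv
    refine ⟨(√(mink (P v) (P v)))⁻¹, ?_⟩
    rw [map_smul, mink_smul_left, mink_smul_right, ← mul_assoc, ← mul_inv, Real.mul_self_sqrt h.le,
      inv_mul_cancel₀ h.ne']
  -- Gram–Schmidt on the standard basis; the induced form is positive definite because its image is
  -- orthogonal to the timelike `x`.
  obtain ⟨f₁, f₂, h11, h22, h12⟩ : ∃ f₁ f₂ : E2, mink (P f₁) (P f₁) = 1 ∧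
      mink (P f₂) (P f₂) = 1 ∧ mink (P f₁) (P f₂) = 0 := by
    set b₀ : E2 := !₂[1, 0]
    set b₁ : E2 := !₂[0, 1]
    obtain ⟨c, h11⟩ := hnormalize b₀ fun h => by
      simpa [b₀] using congrArg (fun y : E2 => y 0) h
    set g : E2 := b₁ - mink (P (c • b₀)) (P b₁) • (c • b₀)
    obtain ⟨d, h22⟩ := hnormalize g fun h => by
      simpa [b₀, b₁, g] using congrArg (fun y : E2 => y 1) h
    refine ⟨c • b₀, d • g, h11, h22, ?_⟩
    rw [map_smul P d, mink_smul_right, map_sub, map_smul P (mink _ _), sub_eq_add_neg,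
      ← neg_smul, mink_add_right, mink_smul_right, h11]
    ring
  obtain ⟨c, s, l, hcs, hl, h0⟩ := exists_diagonalizing_rotation
    (mink (P f₁) (Q f₁)) (mink (P f₁) (Q f₂))
  have h21 : mink (P f₂) (P f₁) = 0 := by rw [mink_comm]; exact h12
  have hII : mink (P f₂) (Q f₁) = mink (P f₁) (Q f₂) := hsymm _ _
  have htr : mink (P f₂) (Q f₂) = - mink (P f₁) (Q f₁) := by linarith [hmin f₁ f₂ h11 h22 h12]
  set a := mink (P f₁) (Q f₁)
  set b := mink (P f₁) (Q f₂)
  set e₁ := c • f₁ + s • f₂ with he₁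
  set e₂ := (-s) • f₁ + c • f₂ with he₂
  have k11 : mink (P e₁) (P e₁) = 1 := by
    simp only [he₁, map_add, map_smul, mink_add_left, mink_add_right, mink_smul_left,
      mink_smul_right, h11, h12, h21, h22]
    linear_combination hcs
  have k22 : mink (P e₂) (P e₂) = 1 := by
    simp only [he₂, map_add, map_smul, mink_add_left, mink_add_right, mink_smul_left,
      mink_smul_right, h11, h12, h21, h22]
    linear_combination hcs
  have k12 : mink (P e₁) (P e₂) = 0 := by
    simp only [he₁, he₂, map_add, map_smul, mink_add_left, mink_add_right, mink_smul_left,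
      mink_smul_right, h11, h12, h21, h22]
    ring
  have q11 : mink (P e₁) (Q e₁) = l := by
    simp only [he₁, map_add, map_smul, mink_add_left, mink_add_right, mink_smul_left,
      mink_smul_right, hII, htr]
    linear_combination hl
  have q12 : mink (P e₁) (Q e₂) = 0 := by
    simp only [he₁, he₂, map_add, map_smul, mink_add_left, mink_add_right, mink_smul_left,
      mink_smul_right, hII, htr]
    linear_combination h0
  have q21 : mink (P e₂) (Q e₁) = 0 := by rw [hsymm, q12]
  have q22 : mink (P e₂) (Q e₂) = -l := by linarith [hmin e₁ e₂ k11 k22 k12]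
  have k21 : mink (P e₂) (P e₁) = 0 := by rw [mink_comm]; exact k12
  -- `x, n, P e₁, P e₂` is a full orthonormal frame of Minkowski space, so a vector orthogonal to
  -- `x` and `n` is determined by its products with `P e₁` and `P e₂`.
  have hzero : ∀ y, mink x y = 0 → mink n y = 0 → mink (P e₁) y = 0 → mink (P e₂) y = 0 → y = 0 :=
    fun y h1 h2 h3 h4 => eq_zero_of_orthogonal_frame hxx hnn k11 k22 hxn (hxP _) (hxP _) (hnP _)
      (hnP _) k12 h1 h2 h3 h4
  have hcomb : ∀ y, mink x y = 0 → mink n y = 0 →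
      y = mink (P e₁) y • P e₁ + mink (P e₂) y • P e₂ := by
    intro y h1 h2
    refine (sub_eq_zero.1 (hzero _ ?_ ?_ ?_ ?_)) <;>
      rw [sub_eq_add_neg, ← neg_one_smul ℝ (_ + _)] <;>
      simp only [mink_add_right, mink_smul_right, hxP, hnP, h1, h2, k11, k12, k21, k22] <;> ring
  refine ⟨e₁, e₂, l, k11, k22, k12, ?_, ?_, fun v => ?_⟩
  · have := hcomb (Q e₁) (hxQ _) (hnQ _)
    rwa [q11, q21, zero_smul, add_zero] at this
  · have := hcomb (Q e₂) (hxQ _) (hnQ _)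
    rwa [q12, q22, zero_smul, zero_add] at this
  · refine ⟨mink (P e₁) (P v), mink (P e₂) (P v), sub_eq_zero.1 (hP _ ?_)⟩
    rw [map_sub, map_add, map_smul, map_smul, sub_eq_zero]
    exact hcomb _ (hxP v) (hnP v)

/-! ### Beltrami coefficients of diagonal metrics -/

/-- If `α²p² + β²q²` and `α²P² + β²Q²` are two quadratic forms on `ℝ²`, then the Beltrami coefficient
of the second one in an orthonormal frame of the first one has modulus
`|P/p - Q/q| / (P/p + Q/q)`. -/
lemma norm_beltrami_eq {V : Type*} {b : V → V → ℝ} {v w : V} {p q P Q α β γ δ : ℝ}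
    (hp : 0 < p) (hq : 0 < q) (hP : 0 < P) (hQ : 0 < Q)
    (hvv : p ^ 2 * α ^ 2 + q ^ 2 * β ^ 2 = 1) (hww : p ^ 2 * γ ^ 2 + q ^ 2 * δ ^ 2 = 1)
    (hvw : p ^ 2 * (α * γ) + q ^ 2 * (β * δ) = 0)
    (hE : b v v = P ^ 2 * α ^ 2 + Q ^ 2 * β ^ 2) (hG : b w w = P ^ 2 * γ ^ 2 + Q ^ 2 * δ ^ 2)
    (hF : b v w = P ^ 2 * (α * γ) + Q ^ 2 * (β * δ)) :
    ‖beltrami b v w‖ = |P * q - Q * p| / (P * q + Q * p) := by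
  have hdet : (p * q * (α * δ - β * γ)) ^ 2 = 1 := by
    linear_combination (p ^ 2 * γ ^ 2 + q ^ 2 * δ ^ 2) * hvv + hww
      - (p ^ 2 * (α * γ) + q ^ 2 * (β * δ)) * hvw
  -- After scaling by `p` and `q` the frame has orthonormal rows, hence orthonormal columns; `h1`
  -- and `h2` read off the column norms.
  have hM : !![p * α, q * β; p * γ, q * δ].transpose * !![p * α, q * β; p * γ, q * δ] = 1 := by
    rw [mul_eq_one_comm]
    ext i j
    fin_cases i <;> fin_cases j <;>
      simp [Matrix.mul_apply, Fin.sum_univ_two] <;> linarith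
  have h1 : p ^ 2 * (α ^ 2 + γ ^ 2) = 1 := by
    have := congrFun (congrFun hM 0) 0
    simp [Matrix.mul_apply, Fin.sum_univ_two] at this
    linarith
  have h2 : q ^ 2 * (β ^ 2 + δ ^ 2) = 1 := by
    have := congrFun (congrFun hM 1) 1
    simp [Matrix.mul_apply, Fin.sum_univ_two] at this
    linarith
  -- The stretch factors along the two axes: the second form has eigenvalues `A²` and `B²` relative
  -- to the first.
  set A := P / p with hA
  set B := Q / q with hB
  have hA0 : 0 < A := div_pos hP hp
  have hB0 : 0 < B := div_pos hQ hq
  have hPA : P = A * p := by rw [hA]; field_simp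
  have hQB : Q = B * q := by rw [hB]; field_simp
  have htr : b v v + b w w = A ^ 2 + B ^ 2 := by
    rw [hE, hG, hPA, hQB]; linear_combination A ^ 2 * h1 + B ^ 2 * h2
  have hd : b v v * b w w - b v w ^ 2 = (A * B) ^ 2 := by
    rw [hE, hG, hF, hPA, hQB]; linear_combination (A * B) ^ 2 * hdet
  have hden : b v v + b w w + 2 * √(b v v * b w w - b v w ^ 2) = (A + B) ^ 2 := by
    rw [htr, hd, Real.sqrt_sq (by positivity)]; ring
  -- The squared modulus is `(E - G)² + 4F² = (E + G)² - 4(EG - F²) = (A² - B²)²`.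
  have hnum : ‖((b v v - b w w : ℝ) : ℂ) + 2 * Complex.I * ((b v w : ℝ) : ℂ)‖ =
      |A - B| * (A + B) := by
    have : ((b v v - b w w : ℝ) : ℂ) + 2 * Complex.I * ((b v w : ℝ) : ℂ) =
        ((b v v - b w w : ℝ) : ℂ) + ((2 * b v w : ℝ) : ℂ) * Complex.I := by push_cast; ring
    rw [this, Complex.norm_add_mul_I, Real.sqrt_eq_iff_mul_self_eq (by positivity) (by positivity)]
    have := abs_mul_abs_self (A - B)
    linear_combination (b v v + b w w + A ^ 2 + B ^ 2) * htr - 4 * hd - (A + B) ^ 2 * this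
  unfold beltrami
  rw [hden, norm_div, hnum, Complex.norm_real, Real.norm_of_nonneg (by positivity), hPA, hQB]
  rw [show A * p * q - B * q * p = (A - B) * (p * q) by ring,
    show A * p * q + B * q * p = (A + B) * (p * q) by ring, abs_mul, abs_of_pos (mul_pos hp hq)]
  field_simp

/-- The dilatation bound is monotone in the principal curvature. -/
lemma dilatation_bound_mono {k l t₁ t₂ : ℝ} (hk : 0 ≤ k) (hkl : k ≤ l) (hl : l ≤ 1)
    (h₁ : |t₁| < 1) (h₂ : |t₂| < 1) :
    k * |t₂ - t₁| / (1 - k ^ 2 * t₁ * t₂) ≤ l * |t₂ - t₁| / (1 - l ^ 2 * t₁ * t₂) := by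
  have ht : |t₁ * t₂| < 1 := by
    rw [abs_mul]; nlinarith [abs_nonneg t₁, abs_nonneg t₂]
  have ht' := abs_lt.1 ht
  have hpos : ∀ m : ℝ, 0 ≤ m → m ≤ 1 → 0 < 1 - m ^ 2 * t₁ * t₂ := by
    intro m hm hm1
    have : m ^ 2 ≤ 1 := pow_le_one₀ hm hm1
    nlinarith [sq_nonneg m]
  rw [div_le_div_iff₀ (hpos k hk (hkl.trans hl)) (hpos l (hk.trans hkl) hl)]
  have hlk : l * k ≤ 1 := by nlinarith
  -- This factor times `|t₂ - t₁|` is the difference of the cross-multiplied sides.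
  have key : 0 ≤ (l - k) * (1 + l * k * (t₁ * t₂)) := by
    apply mul_nonneg (by linarith)
    nlinarith [mul_nonneg (hk.trans hkl) hk]
  nlinarith [mul_nonneg key (abs_nonneg (t₂ - t₁))]

/-- The dilatation bound in terms of `(1 + λ tanh r) / (1 - λ tanh r)`. -/
lemma dilatation_bound_eq {l t₁ t₂ : ℝ} (hl : 0 ≤ l) (hl1 : l ≤ 1) (h₁ : |t₁| < 1) (h₂ : |t₂| < 1) :
    l * |t₂ - t₁| / (1 - l ^ 2 * t₁ * t₂) =
      (Real.exp |Real.log ((1 + l * t₂) / (1 - l * t₂)) - Real.log ((1 + l * t₁) / (1 - l * t₁))|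
        - 1) /
      (Real.exp |Real.log ((1 + l * t₂) / (1 - l * t₂)) - Real.log ((1 + l * t₁) / (1 - l * t₁))|
        + 1) := by
  wlog h : t₁ ≤ t₂ generalizing t₁ t₂
  · rw [abs_sub_comm, abs_sub_comm (Real.log _),
      show 1 - l ^ 2 * t₁ * t₂ = 1 - l ^ 2 * t₂ * t₁ by ring]
    exact this h₂ h₁ (le_of_not_ge h)
  have hlt : ∀ t : ℝ, |t| < 1 → 0 < 1 + l * t ∧ 0 < 1 - l * t := by
    intro t ht
    have := abs_lt.1 ht
    constructor <;> nlinarith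
  obtain ⟨a₁, b₁⟩ := hlt t₁ h₁
  obtain ⟨a₂, b₂⟩ := hlt t₂ h₂
  have hle : (1 + l * t₁) / (1 - l * t₁) ≤ (1 + l * t₂) / (1 - l * t₂) := by
    have := mul_le_mul_of_nonneg_left h hl
    gcongr
  have hlog := Real.log_le_log (div_pos a₁ b₁) hle
  rw [abs_of_nonneg (sub_nonneg.2 h), abs_of_nonneg (sub_nonneg.2 hlog), Real.exp_sub,
    Real.exp_log (div_pos a₂ b₂), Real.exp_log (div_pos a₁ b₁)]
  -- Twice this quantity is `(1 + l t₁)(1 - l t₂) + (1 + l t₂)(1 - l t₁)`, a sum of positive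
  -- products.
  have hd : 1 - l ^ 2 * t₁ * t₂ ≠ 0 := by nlinarith [mul_pos a₁ b₂, mul_pos a₂ b₁]
  have hs : (1 + l * t₂) * (1 - l * t₁) + (1 - l * t₂) * (1 + l * t₁) ≠ 0 := by positivity
  have e : (1 + l * t₂) / (1 - l * t₂) / ((1 + l * t₁) / (1 - l * t₁)) =
      ((1 + l * t₂) * (1 - l * t₁)) / ((1 - l * t₂) * (1 + l * t₁)) := by
    field_simp
  rw [e, div_sub_one (by positivity), div_add_one (by positivity),
    div_div_div_cancel_right₀ (by positivity), div_eq_div_iff hd hs]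
  ring

/-! ### Metrics of the parallel surfaces and the normal flow map -/

section

variable {S : Type*} [TopologicalSpace S] [ChartedSpace E2 S] {Γ : Subgroup SL4}

/-- The metrics of all parallel surfaces are diagonal in a frame of principal directions. -/
lemma exists_frame_parallelSurface [IsManifold (𝓡 2) ∞ S] (hΓ : IsQuasiFuchsian Γ)
    {N : S → T1M Γ} (hN : IsImmersedSurface N) (hmin : IsMinimal N) (p : S) :
    ∃ (e₁ e₂ : TangentSpace (𝓡 2) p) (l : ℝ),
      IsPrincipalCurvature N p l ∧ IsPrincipalCurvature N p (-l) ∧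
      (∀ v, ∃ α β : ℝ, v = α • e₁ + β • e₂) ∧
      ∀ r α β γ δ : ℝ,
        firstForm (parallelSurface N r) p (α • e₁ + β • e₂) (γ • e₁ + δ • e₂) =
          (Real.cosh r + l * Real.sinh r) ^ 2 * (α * γ) +
          (Real.cosh r - l * Real.sinh r) ^ 2 * (β * δ) := by
  obtain ⟨L, hL, hinj, hn⟩ := hN p
  let P : E2 →ₗ[ℝ] Mink := (mfderiv (𝓡 2) 𝓘(ℝ, Mink) (fun q => (L q).pos) p).toLinearMap
  let Q : E2 →ₗ[ℝ] Mink := (mfderiv (𝓡 2) 𝓘(ℝ, Mink) (fun q => (L q).vec) p).toLinearMap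
  have hI : ∀ v w : E2, firstForm N p v w = mink (P v) (P w) := fun v w => (hL.forms_eq hΓ v w).1
  have hII : ∀ v w : E2, secondForm N p v w = mink (P v) (Q w) := fun v w => (hL.forms_eq hΓ v w).2
  have hnP : ∀ v, mink (L p).vec (P v) = 0 := fun v => (mink_comm _ _).trans (hn.self_of_nhds v)
  have hsymm : ∀ v w, mink (P v) (Q w) = mink (P w) (Q v) := hL.mink_diffl_symm hn
  obtain ⟨e₁, e₂, l, h11, h22, h12, hQ1, hQ2, hspan⟩ := exists_principal_frame
    (L p).pos_form (L p).unit (L p).orth P Q hinj (fun v => (hL.mink_diffl v).1) hnP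
    (fun v => by
      have h : mink (L p).pos (Q v) + mink (P v) (L p).vec = 0 := (hL.mink_diffl v).2.2
      rw [mink_comm (P v), hnP, add_zero] at h
      exact h)
    (fun v => (hL.mink_diffl v).2.1) hsymm
    (fun v w hv hw hvw => by
      rw [← hII, ← hII]
      exact hmin p v w ⟨(hI v v).trans hv, (hI w w).trans hw, (hI v w).trans hvw⟩)
  have h21 : mink (P e₂) (P e₁) = 0 := by rw [mink_comm]; exact h12
  have hprin : ∀ (e : E2) (k : ℝ), Q e = k • P e → ∀ w : E2,
      secondForm N p e w = k * firstForm N p e w := by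
    intro e k hk w
    have h : mink (P e) (Q w) = k * mink (P e) (P w) := by
      rw [hsymm, hk, mink_smul_right, mink_comm]
    exact (hII e w).trans (h.trans (congrArg (k * ·) (hI e w).symm))
  refine ⟨e₁, e₂, l, ⟨e₁, ?_, fun w => ?_⟩, ⟨e₂, ?_, fun w => ?_⟩, hspan, fun r α β γ δ => ?_⟩
  · rintro h
    rw [show P e₁ = 0 from (congrArg P h).trans (map_zero P)] at h11
    simp [mink] at h11
  · exact hprin e₁ l hQ1 w
  · rintro h
    rw [show P e₂ = 0 from (congrArg P h).trans (map_zero P)] at h22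
    simp [mink] at h22
  · exact hprin e₂ (-l) hQ2 w
  -- The flowed differential is `cosh r • P + sinh r • Q`, and `Q` acts as `±l` on the principal
  -- directions.
  · have hd : ∀ a b : ℝ, diffl (fun q => ((L q).flow r).pos) p (a • e₁ + b • e₂) =
        (a * (Real.cosh r + l * Real.sinh r)) • P e₁ +
          (b * (Real.cosh r - l * Real.sinh r)) • P e₂ := by
      intro a b
      refine (hL.diffl_flow_pos r _).trans ?_
      change Real.cosh r • P (a • e₁ + b • e₂) + Real.sinh r • Q (a • e₁ + b • e₂) = _
      rw [map_add, map_add, map_smul, map_smul, map_smul, map_smul, hQ1, hQ2]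
      module
    refine ((hL.flow r).forms_eq hΓ _ _).1.trans ?_
    refine (congrArg₂ mink (hd α β) (hd γ δ)).trans ?_
    simp only [mink_add_left, mink_add_right, mink_smul_left, mink_smul_right, h11, h12, h21, h22]
    ring

/-- Needed for `maxPrincipalCurvature` to be a true supremum: `sSup` of an unbounded set of reals is
`0` by default. -/
lemma bddAbove_principalCurvatures {N : S → T1M Γ}
    (h : ∀ p κ, IsPrincipalCurvature N p κ → -1 < κ ∧ κ < 1) :
    BddAbove {κ | ∃ p, IsPrincipalCurvature N p κ} :=
  ⟨1, fun _ ⟨p, hκ⟩ => (h p _ hκ).2.le⟩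

/-- Holds because `|sinh r| < cosh r`. Applied to `l` and `-l`, it says that no parallel surface
degenerates. -/
lemma cosh_add_mul_sinh_pos {l : ℝ} (h : |l| < 1) (r : ℝ) : 0 < Real.cosh r + l * Real.sinh r := by
  have hs : |Real.sinh r| < Real.cosh r :=
    abs_lt_of_sq_lt_sq (by nlinarith [Real.cosh_sq r]) (Real.cosh_pos r).le
  have h1 : |l * Real.sinh r| ≤ |Real.sinh r| := by
    rw [abs_mul]; exact mul_le_of_le_one_left (abs_nonneg _) h.le
  linarith [neg_abs_le (l * Real.sinh r)]

/-- Cancel `2 cosh r₁ cosh r₂`. The modulus `|l|` replaces `l` so that monotonicity in a nonnegative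
curvature applies. -/
lemma dilatation_eq_tanh (l r₁ r₂ : ℝ) :
    |(Real.cosh r₂ + l * Real.sinh r₂) * (Real.cosh r₁ - l * Real.sinh r₁) -
        (Real.cosh r₂ - l * Real.sinh r₂) * (Real.cosh r₁ + l * Real.sinh r₁)| /
      ((Real.cosh r₂ + l * Real.sinh r₂) * (Real.cosh r₁ - l * Real.sinh r₁) +
        (Real.cosh r₂ - l * Real.sinh r₂) * (Real.cosh r₁ + l * Real.sinh r₁)) =
    |l| * |Real.tanh r₂ - Real.tanh r₁| / (1 - |l| ^ 2 * Real.tanh r₁ * Real.tanh r₂) := by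
  have h1 := Real.cosh_pos r₁
  have h2 := Real.cosh_pos r₂
  have hs : ∀ r, Real.sinh r = Real.cosh r * Real.tanh r := fun r => by
    rw [Real.tanh_eq_sinh_div_cosh, mul_div_cancel₀ _ (Real.cosh_pos r).ne']
  rw [hs r₁, hs r₂, sq_abs, ← abs_mul]
  set c₁ := Real.cosh r₁
  set c₂ := Real.cosh r₂
  set t₁ := Real.tanh r₁
  set t₂ := Real.tanh r₂
  rw [show (c₂ + l * (c₂ * t₂)) * (c₁ - l * (c₁ * t₁)) - (c₂ - l * (c₂ * t₂)) * (c₁ + l * (c₁ * t₁))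
      = (2 * (c₁ * c₂)) * (l * (t₂ - t₁)) by ring,
    show (c₂ + l * (c₂ * t₂)) * (c₁ - l * (c₁ * t₁)) + (c₂ - l * (c₂ * t₂)) * (c₁ + l * (c₁ * t₁))
      = (2 * (c₁ * c₂)) * (1 - l ^ 2 * t₁ * t₂) by ring,
    abs_mul, abs_of_pos (show 0 < 2 * (c₁ * c₂) by positivity),
    mul_div_mul_left _ _ (show 2 * (c₁ * c₂) ≠ 0 by positivity)]

lemma abs_tanh_lt_one (r : ℝ) : |Real.tanh r| < 1 :=
  abs_lt.2 ⟨Real.neg_one_lt_tanh r, Real.tanh_lt_one r⟩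

/-- The maximal principal curvature bounds the modulus of principal curvatures, and is at most
one. -/
lemma IsAlmostFuchsianSurface.maxPrincipalCurvature_mem_Icc [IsManifold (𝓡 2) ∞ S] [Nonempty S]
    (hΓ : IsQuasiFuchsian Γ) {N : S → T1M Γ} (hN : IsAlmostFuchsianSurface N) :
    0 ≤ maxPrincipalCurvature N ∧ maxPrincipalCurvature N ≤ 1 := by
  obtain ⟨p⟩ := ‹Nonempty S›
  obtain ⟨-, -, l, hl, hl', -⟩ := exists_frame_parallelSurface hΓ hN.immersed hN.minimal p
  have hb := bddAbove_principalCurvatures hN.curvature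
  -- Minimality makes both `l` and `-l` principal curvatures, so their supremum is nonnegative.
  have h1 : l ≤ maxPrincipalCurvature N := le_csSup hb ⟨p, hl⟩
  have h2 : -l ≤ maxPrincipalCurvature N := le_csSup hb ⟨p, hl'⟩
  exact ⟨by linarith, csSup_le ⟨l, p, hl⟩ fun κ ⟨q, hκ⟩ => (hN.curvature q κ hκ).2.le⟩

/-- The Beltrami coefficient of the normal flow map between parallel surfaces. -/
lemma IsAlmostFuchsianSurface.norm_beltrami_le [IsManifold (𝓡 2) ∞ S]
    (hΓ : IsQuasiFuchsian Γ) {N : S → T1M Γ} (hN : IsAlmostFuchsianSurface N) (r₁ r₂ : ℝ) (p : S)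
    (v w : TangentSpace (𝓡 2) p)
    (hvw : IsOrthoFrame (firstForm (parallelSurface N r₁)) p v w) :
    ‖beltrami (pullback (firstForm (parallelSurface N r₂)) id p) v w‖ ≤
      maxPrincipalCurvature N * |Real.tanh r₂ - Real.tanh r₁| /
        (1 - maxPrincipalCurvature N ^ 2 * Real.tanh r₁ * Real.tanh r₂) := by
  have : Nonempty S := ⟨p⟩
  have hpull : pullback (firstForm (parallelSurface N r₂)) id p =
      firstForm (parallelSurface N r₂) p := by
    funext v w
    unfold pullback
    rw [mfderiv_id]
    rfl
  obtain ⟨e₁, e₂, l, hl, hl', hspan, hform⟩ :=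
    exists_frame_parallelSurface hΓ hN.immersed hN.minimal p
  obtain ⟨α, β, rfl⟩ := hspan v
  obtain ⟨γ, δ, rfl⟩ := hspan w
  obtain ⟨hv, hw, ho⟩ := hvw
  rw [hform] at hv hw ho
  have hb := bddAbove_principalCurvatures hN.curvature
  have hl1 : |l| < 1 := abs_lt.2 (hN.curvature p l hl)
  have hl1' : |-l| < 1 := by rwa [abs_neg]
  have hpos := cosh_add_mul_sinh_pos hl1
  have hneg : ∀ r, 0 < Real.cosh r - l * Real.sinh r := fun r => by
    have := cosh_add_mul_sinh_pos hl1' r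
    linarith
  rw [hpull, norm_beltrami_eq (hpos r₁) (hneg r₁) (hpos r₂) (hneg r₂) (α := α) (β := β) (γ := γ)
    (δ := δ) (by linarith) (by linarith) ho (by rw [hform]; ring) (by rw [hform]; ring)
    (by rw [hform]), dilatation_eq_tanh]
  exact dilatation_bound_mono (abs_nonneg l)
    (abs_le'.2 ⟨le_csSup hb ⟨p, hl⟩, le_csSup hb ⟨p, hl'⟩⟩)
    (hN.maxPrincipalCurvature_mem_Icc hΓ).2 (abs_tanh_lt_one _) (abs_tanh_lt_one _)

/-! ### The Teichmüller distance -/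

/-- Along segments inside `U` the map is 1-Lipschitz. Equality only on `U` is assumed because a
chart composed with its inverse is the identity only on its target. -/
lemma isACL_of_eqOn_id {U : Set E2} {h : E2 → E2} (hh : ∀ x ∈ U, h x = x) : IsACL U h := by
  intro a b c d hab hcd hU
  refine ⟨Eventually.of_forall fun y hy => ?_, Eventually.of_forall fun x hx => ?_⟩
  · refine LipschitzOnWith.absolutelyContinuousOnInterval (K := 1) ?_
    rw [uIcc_of_le hab]
    refine LipschitzOnWith.of_dist_le_mul fun s hs t ht => ?_
    rw [hh _ (hU s hs y hy), hh _ (hU t ht y hy)]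
    simp [EuclideanSpace.dist_eq, Real.dist_eq, Real.sqrt_sq_eq_abs]
  · refine LipschitzOnWith.absolutelyContinuousOnInterval (K := 1) ?_
    rw [uIcc_of_le hcd]
    refine LipschitzOnWith.of_dist_le_mul fun s hs t ht => ?_
    rw [hh _ (hU x hx s hs), hh _ (hU x hx t ht)]
    simp [EuclideanSpace.dist_eq, Real.dist_eq, Real.sqrt_sq_eq_abs]

/-- The identity map is quasiconformal when its Beltrami coefficient is bounded. -/
lemma isQuasiconformalWith_refl {g₁ g₂ : FormField S} {K : ℝ} (hK : 1 ≤ K)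
    (h : ∀ p v w, IsOrthoFrame g₁ p v w → ‖beltrami (pullback g₂ id p) v w‖ ≤ (K - 1) / (K + 1)) :
    IsQuasiconformalWith g₁ g₂ (Homeomorph.refl S) K := by
  refine ⟨hK, fun p => isACL_of_eqOn_id ?_, fun p => ?_⟩
  · rintro _ ⟨q, ⟨hq, -⟩, rfl⟩
    change chartAt E2 p ((chartAt E2 p).symm (chartAt E2 p q)) = chartAt E2 p q
    rw [(chartAt E2 p).left_inv hq]
  · have : {p : S | ¬ (MDifferentiableAt (𝓡 2) (𝓡 2) (Homeomorph.refl S) p ∧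
        ∀ v w, IsOrthoFrame g₁ p v w →
          ‖beltrami (pullback g₂ (Homeomorph.refl S) p) v w‖ ≤ (K - 1) / (K + 1))} = ∅ :=
      eq_empty_of_forall_notMem fun q hq => hq ⟨mdifferentiableAt_id, h q⟩
    rw [this]
    simp

/-- The identity is an admissible competitor. Every maximal dilatation is at least `1`, so the
infimum is bounded below and positive, as monotonicity of the logarithm requires. -/
lemma teichDist_le_of_beltrami_le {g₁ g₂ : FormField S} {K : ℝ} (hK : 1 ≤ K)
    (h : ∀ p v w, IsOrthoFrame g₁ p v w → ‖beltrami (pullback g₂ id p) v w‖ ≤ (K - 1) / (K + 1)) :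
    teichDist g₁ g₂ ≤ 1 / 2 * Real.log K := by
  have hid := isQuasiconformalWith_refl hK h
  have hone : ∀ {f : S ≃ₜ S}, (∃ K, IsQuasiconformalWith g₁ g₂ f K) → 1 ≤ maxDilatation g₁ g₂ f :=
    fun hf => le_csInf hf fun _ hK => hK.1
  have hle : maxDilatation g₁ g₂ (Homeomorph.refl S) ≤ K :=
    csInf_le ⟨1, fun _ hK => hK.1⟩ hid
  have hmem : maxDilatation g₁ g₂ (Homeomorph.refl S) ∈ {k | ∃ f : S ≃ₜ S,
      ContinuousMap.Homotopic (f : C(S, S)) (ContinuousMap.id S) ∧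
      (∃ K, IsQuasiconformalWith g₁ g₂ f K) ∧ k = maxDilatation g₁ g₂ f} :=
    ⟨Homeomorph.refl S, ContinuousMap.Homotopic.refl _, ⟨K, hid⟩, rfl⟩
  unfold teichDist
  refine mul_le_mul_of_nonneg_left (Real.log_le_log ?_ ((csInf_le ⟨1, ?_⟩ hmem).trans hle))
    (by norm_num)
  · refine zero_lt_one.trans_le (le_csInf ⟨_, hmem⟩ ?_)
    rintro _ ⟨f, -, hf, rfl⟩
    exact hone hf
  · rintro _ ⟨f, -, hf, rfl⟩
    exact hone hf

end

end AlmostFuchsian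

theorem theorem1p2
    (Γ : Subgroup SL4) (hΓ : IsQuasiFuchsian Γ)
    {S : Type*} [TopologicalSpace S] [ChartedSpace E2 S] [IsManifold (𝓡 2) ∞ S]
    [T2Space S] [CompactSpace S] [ConnectedSpace S]
    (N : S → T1M Γ) (hN : IsAlmostFuchsianSurface N)
    (lam0 : ℝ) (hlam0 : lam0 = maxPrincipalCurvature N) :
    (∀ r : ℝ, teichDist (firstForm N) (firstForm (parallelSurface N r)) ≤
      1 / 2 * |Real.log ((1 + lam0 * Real.tanh r) / (1 - lam0 * Real.tanh r))|) ∧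
    (∀ r₁ r₂ : ℝ,
      teichDist (firstForm (parallelSurface N r₁)) (firstForm (parallelSurface N r₂)) ≤
      1 / 2 * |Real.log ((1 + lam0 * Real.tanh r₂) / (1 - lam0 * Real.tanh r₂)) -
        Real.log ((1 + lam0 * Real.tanh r₁) / (1 - lam0 * Real.tanh r₁))|) ∧
    (∀ r₁ r₂ : ℝ, ∀ (p : S) (v w : TangentSpace (𝓡 2) p),
      IsOrthoFrame (firstForm (parallelSurface N r₁)) p v w →
      ‖beltrami (pullback (firstForm (parallelSurface N r₂)) id p) v w‖ ≤
        lam0 * |Real.tanh r₂ - Real.tanh r₁| /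
          (1 - lam0 ^ 2 * Real.tanh r₁ * Real.tanh r₂)) := by
  subst hlam0
  have hmem := hN.maxPrincipalCurvature_mem_Icc hΓ
  have hdist : ∀ r₁ r₂ : ℝ,
      teichDist (firstForm (parallelSurface N r₁)) (firstForm (parallelSurface N r₂)) ≤
      1 / 2 * |Real.log ((1 + maxPrincipalCurvature N * Real.tanh r₂) /
          (1 - maxPrincipalCurvature N * Real.tanh r₂)) -
        Real.log ((1 + maxPrincipalCurvature N * Real.tanh r₁) /
          (1 - maxPrincipalCurvature N * Real.tanh r₁))| := by
    intro r₁ r₂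
    -- Here `K` is the exponential of the absolute difference of logarithms.
    refine (teichDist_le_of_beltrami_le (Real.one_le_exp (abs_nonneg _))
      fun p v w hvw => ?_).trans_eq (congrArg _ (Real.log_exp _))
    rw [← dilatation_bound_eq hmem.1 hmem.2 (abs_tanh_lt_one r₁) (abs_tanh_lt_one r₂)]
    exact hN.norm_beltrami_le hΓ r₁ r₂ p v w hvw
  refine ⟨fun r => ?_, hdist, hN.norm_beltrami_le hΓ⟩
  -- At `r₁ = 0` the surface is `S` itself, and the second logarithm is `log 1 = 0`.
  simpa [parallelSurface_zero] using hdist 0 r
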